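/- Let $C([0,\infty])$ be the Banach space of continuous (real- or complex-valued) functions on $[0,\infty)$ that have a finite limit at $\infty$, with the sup-norm $\|\cdot\|_\infty$. For $\gamma,b>0$ let $A^{\gamma,b}u(x)=\gamma x u''(x)+b u'(x)$ with domain $$D(A^{\gamma,b})=\Big\{u\in C^1([0,\infty))\cap C^2((0,\infty))\cap C([0,\infty]) \;:\; \lim_{x\to0^+}xu''(x)=0,\ \lim_{x\to+\infty}A^{\gamma,b}u(x)=0\Big\}$$ (for $u\in D(A^{\gamma,b})$ the function $A^{\gamma,b}u$ is extended continuously to $0$ by the value $b\,u'(0)$). There is an absolute constant $C>0$ (in particular, independent of $b$) such that for all $\gamma,b>0$ and all $\lambda>0$ the following holds. The number $\lambda$ belongs to the resolvent set of $A^{\gamma,b}$; for every $f\in C([0,\infty])$ the function $R(\lambda,A^{\gamma,b})f=(\lambda-A^{\gamma,b})^{-1}f$ is differentiable on $[0,\infty)$ (one-sidedly at $0$), its derivative belongs to $C([0,\infty])$, and $$\big\|(R(\lambda,A^{\gamma,b})f)'\big\|_\infty\le \frac1\gamma\max\Big\{2,\frac{\gamma}{b}\Big\}\,C\,\|f\|_\infty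 .$$ That is, $f\mapsto (R(\lambda,A^{\gamma,b})f)'$ is a bounded linear operator from $C([0,\infty])$ into itself, with norm at most $\frac1\gamma\max\{2,\frac\gamma b\}\,C$. -/

import Mathlib

open Set Filter Topology
open scoped NNReal BoundedContinuousFunction

noncomputable section

namespace HalfLine

/-- The Banach space `C([0,∞])`: the continuous functions on `[0,∞)` with values in `𝕜` that have a
finite limit at infinity, with the sup-norm (inherited from the bounded continuous functions). -/
def CInfty (𝕜 : Type*) [RCLike 𝕜] : Submodule 𝕜 (ℝ≥0 →ᵇ 𝕜) where
  carrier := {f | ∃ l : 𝕜, Tendsto (fun x : ℝ≥0 => f x) atTop (𝓝 l)}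
  add_mem' := by
    rintro f g ⟨l, hl⟩ ⟨m, hm⟩
    exact ⟨l + m, by simpa using hl.add hm⟩
  zero_mem' := ⟨0, by simp⟩
  smul_mem' := by
    rintro c f ⟨l, hl⟩
    exact ⟨c • l, by simpa using hl.const_smul c⟩

variable {𝕜 : Type*} [RCLike 𝕜]

/-- A function in `C([0,∞])` as a function of a real variable. Only its values on `[0,∞)` matter;
on the negative half-line it is given the value at `0`. -/
def onReal (u : CInfty 𝕜) (x : ℝ) : 𝕜 := u.1 x.toNNReal

/-- A continuous function on `[0,∞)` with a limit at infinity is an element of `C([0,∞])`. -/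
theorem exists_mem_CInfty (g : ℝ → 𝕜) (hg : ContinuousOn g (Ici 0)) (l : 𝕜)
    (hl : Tendsto g atTop (𝓝 l)) :
    ∃ v : CInfty 𝕜, ∀ x : ℝ≥0, v.1 x = g x := by
  have hc : Continuous (fun x : ℝ≥0 => g x) :=
    hg.comp_continuous NNReal.continuous_coe (fun x => x.2)
  have hlim : Tendsto (fun x : ℝ≥0 => g x) atTop (𝓝 l) :=
    hl.comp (NNReal.tendsto_coe_atTop.2 tendsto_id)
  have hbd : ∃ K : ℝ, ∀ x : ℝ≥0, ‖g x‖ ≤ K := by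
    have h1 : ∀ᶠ x : ℝ≥0 in atTop, ‖g x‖ ≤ ‖l‖ + 1 :=
      (hlim.norm.eventually_lt_const (lt_add_one ‖l‖)).mono fun _ h => h.le
    obtain ⟨M, hM⟩ := eventually_atTop.1 h1
    obtain ⟨K, hK⟩ := (isCompact_Icc (a := (0 : ℝ≥0)) (b := M)).exists_bound_of_continuousOn
      hc.continuousOn
    refine ⟨max K (‖l‖ + 1), fun x => ?_⟩
    rcases le_total x M with h | h
    · exact (hK x ⟨zero_le, h⟩).trans (le_max_left _ _)
    · exact (hM x h).trans (le_max_right _ _)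
  obtain ⟨K, hK⟩ := hbd
  exact ⟨⟨BoundedContinuousFunction.ofNormedAddCommGroup _ hc K hK, l, hlim⟩, fun x => rfl⟩

/-- The expression `γ x u''(x) + b u'(x)` for `x ≥ 0`. The derivative at the end point `0` is the
one-sided one, and at `x = 0` the first term vanishes, so that the value there is `b u'(0)`. -/
def diffExpr (γ b : ℝ) (u : ℝ → 𝕜) (x : ℝ) : 𝕜 :=
  (γ * x) • deriv (deriv u) x + b • derivWithin u (Ici 0) x

/-- Membership in the domain of `A u = γ x u'' + b u'` on `C([0,∞])`, for `γ, b > 0`: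
`u ∈ C([0,∞]) ∩ C¹([0,∞)) ∩ C²((0,∞))`, `x u''(x) → 0` as `x → 0⁺`, and
`A u(x) → 0` as `x → ∞`. -/
structure InDomain (γ b : ℝ) (u : CInfty 𝕜) : Prop where
  contDiffOn_one : ContDiffOn ℝ 1 (onReal u) (Ici 0)
  contDiffOn_two : ContDiffOn ℝ 2 (onReal u) (Ioi 0)
  tendsto_zero : Tendsto (fun x : ℝ => x • deriv (deriv (onReal u)) x) (𝓝[>] 0) (𝓝 0)
  tendsto_infty : Tendsto (diffExpr γ b (onReal u)) atTop (𝓝 0)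

theorem onReal_add (u v : CInfty 𝕜) : onReal (u + v) = onReal u + onReal v := rfl

theorem onReal_smul (c : 𝕜) (u : CInfty 𝕜) : onReal (c • u) = c • onReal u := rfl

section calculus

variable {u v : ℝ → 𝕜}

theorem differentiableAt_of_Ioi (hu : ContDiffOn ℝ 2 u (Ioi 0)) {x : ℝ} (hx : 0 < x) :
    DifferentiableAt ℝ u x :=
  (hu.differentiableOn (by norm_num)).differentiableAt (Ioi_mem_nhds hx)

theorem contDiffOn_deriv (hu : ContDiffOn ℝ 2 u (Ioi 0)) :
    ContDiffOn ℝ 1 (deriv u) (Ioi 0) :=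
  hu.deriv_of_isOpen isOpen_Ioi (by norm_num)

theorem differentiableAt_deriv (hu : ContDiffOn ℝ 2 u (Ioi 0)) {x : ℝ} (hx : 0 < x) :
    DifferentiableAt ℝ (deriv u) x :=
  ((contDiffOn_deriv hu).differentiableOn (by norm_num)).differentiableAt (Ioi_mem_nhds hx)

theorem deriv_deriv_add (hu : ContDiffOn ℝ 2 u (Ioi 0)) (hv : ContDiffOn ℝ 2 v (Ioi 0))
    {x : ℝ} (hx : 0 < x) :
    deriv (deriv (u + v)) x = deriv (deriv u) x + deriv (deriv v) x := by
  have h : deriv (u + v) =ᶠ[𝓝 x] deriv u + deriv v := by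
    filter_upwards [Ioi_mem_nhds hx] with y hy
    exact deriv_add (differentiableAt_of_Ioi hu hy) (differentiableAt_of_Ioi hv hy)
  rw [h.deriv_eq]
  exact deriv_add (differentiableAt_deriv hu hx) (differentiableAt_deriv hv hx)

theorem deriv_deriv_smul (hu : ContDiffOn ℝ 2 u (Ioi 0)) (c : 𝕜) {x : ℝ} (hx : 0 < x) :
    deriv (deriv (c • u)) x = c • deriv (deriv u) x := by
  have h : deriv (c • u) =ᶠ[𝓝 x] c • deriv u := by
    filter_upwards [Ioi_mem_nhds hx] with y hy
    exact deriv_const_smul c (differentiableAt_of_Ioi hu hy)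
  rw [h.deriv_eq]
  exact deriv_const_smul c (differentiableAt_deriv hu hx)

theorem diffExpr_add (γ b : ℝ) (hu1 : ContDiffOn ℝ 1 u (Ici 0)) (hv1 : ContDiffOn ℝ 1 v (Ici 0))
    (hu : ContDiffOn ℝ 2 u (Ioi 0)) (hv : ContDiffOn ℝ 2 v (Ioi 0)) {x : ℝ} (hx : 0 ≤ x) :
    diffExpr γ b (u + v) x = diffExpr γ b u x + diffExpr γ b v x := by
  have h1 : derivWithin (u + v) (Ici 0) x = derivWithin u (Ici 0) x + derivWithin v (Ici 0) x :=
    derivWithin_add (hu1.differentiableOn (by norm_num) x hx)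
      (hv1.differentiableOn (by norm_num) x hx)
  unfold diffExpr
  rw [h1]
  rcases hx.eq_or_lt with rfl | h0
  · simp [smul_add]
  · rw [deriv_deriv_add hu hv h0, smul_add, smul_add]
    abel

theorem diffExpr_smul (γ b : ℝ) (hu1 : ContDiffOn ℝ 1 u (Ici 0))
    (hu : ContDiffOn ℝ 2 u (Ioi 0)) (c : 𝕜) {x : ℝ} (hx : 0 ≤ x) :
    diffExpr γ b (c • u) x = c • diffExpr γ b u x := by
  have h1 : derivWithin (c • u) (Ici 0) x = c • derivWithin u (Ici 0) x :=
    derivWithin_const_smul c (hu1.differentiableOn (by norm_num) x hx)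
  unfold diffExpr
  rw [h1]
  rcases hx.eq_or_lt with rfl | h0
  · simp
  · rw [deriv_deriv_smul hu c h0, smul_add, smul_comm b c, smul_comm (γ * x) c]

end calculus

theorem InDomain.add {γ b : ℝ} {u v : CInfty 𝕜} (hu : InDomain γ b u) (hv : InDomain γ b v) :
    InDomain γ b (u + v) where
  contDiffOn_one := hu.1.add hv.1
  contDiffOn_two := hu.2.add hv.2
  tendsto_zero := by
    have h := hu.3.add hv.3
    rw [add_zero] at h
    refine h.congr' ?_
    filter_upwards [self_mem_nhdsWithin] with x hx
    rw [onReal_add, deriv_deriv_add hu.2 hv.2 hx, smul_add]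
  tendsto_infty := by
    have h := hu.4.add hv.4
    rw [add_zero] at h
    refine h.congr' ?_
    filter_upwards [Ici_mem_atTop (0 : ℝ)] with x hx
    exact (diffExpr_add γ b hu.1 hv.1 hu.2 hv.2 hx).symm

theorem InDomain.smul {γ b : ℝ} {u : CInfty 𝕜} (c : 𝕜) (hu : InDomain γ b u) :
    InDomain γ b (c • u) where
  contDiffOn_one := contDiffOn_const.smul hu.1
  contDiffOn_two := contDiffOn_const.smul hu.2
  tendsto_zero := by
    have h := hu.3.const_smul c
    rw [smul_zero] at h
    refine h.congr' ?_
    filter_upwards [self_mem_nhdsWithin] with x hx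
    rw [onReal_smul, deriv_deriv_smul hu.2 c hx, smul_comm x c]
  tendsto_infty := by
    have h := hu.4.const_smul c
    rw [smul_zero] at h
    refine h.congr' ?_
    filter_upwards [Ici_mem_atTop (0 : ℝ)] with x hx
    exact (diffExpr_smul γ b hu.1 hu.2 c hx).symm

theorem inDomain_zero (γ b : ℝ) : InDomain γ b (0 : CInfty 𝕜) := by
  have h0 : onReal (0 : CInfty 𝕜) = fun _ => 0 := rfl
  have h1 : diffExpr γ b (onReal (0 : CInfty 𝕜)) = fun _ => 0 := by
    funext x
    simp [diffExpr, h0]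
  refine ⟨?_, ?_, ?_, ?_⟩
  · rw [h0]; exact contDiffOn_const
  · rw [h0]; exact contDiffOn_const
  · simp [h0]
  · rw [h1]; exact tendsto_const_nhds

/-- For `u` in the domain, `γ x u'' + b u'` is continuous up to `0`. -/
theorem InDomain.continuousOn {γ b : ℝ} {u : CInfty 𝕜} (hu : InDomain γ b u) :
    ContinuousOn (diffExpr γ b (onReal u)) (Ici 0) := by
  have h1 : ContinuousOn (fun x => b • derivWithin (onReal u) (Ici 0) x) (Ici 0) :=
    (hu.1.continuousOn_derivWithin (uniqueDiffOn_Ici 0) le_rfl).const_smul b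
  refine ContinuousOn.add (fun x hx => ?_) h1
  rcases (mem_Ici.1 hx).eq_or_lt with rfl | h0
  · rw [← continuousWithinAt_Ioi_iff_Ici]
    have h := hu.3.const_smul γ
    rw [smul_zero] at h
    unfold ContinuousWithinAt
    simpa [mul_smul] using h
  · have h2 : ContinuousAt (deriv (deriv (onReal u))) x :=
      ((contDiffOn_deriv hu.2).continuousOn_deriv_of_isOpen isOpen_Ioi le_rfl).continuousAt
        (Ioi_mem_nhds h0)
    exact ((continuousAt_const.mul continuousAt_id).smul h2).continuousWithinAt

theorem InDomain.exists_value {γ b : ℝ} {u : CInfty 𝕜} (hu : InDomain γ b u) :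
    ∃ v : CInfty 𝕜, ∀ x : ℝ≥0, v.1 x = diffExpr γ b (onReal u) x :=
  exists_mem_CInfty _ hu.continuousOn 0 hu.tendsto_infty

variable (𝕜) in
/-- The operator `A u = γ x u'' + b u'` in `C([0,∞])` (for `γ, b > 0`), with the domain above. -/
def opA (γ b : ℝ) : CInfty 𝕜 →ₗ.[𝕜] CInfty 𝕜 where
  domain :=
    { carrier := {u | InDomain γ b u}
      add_mem' := fun hu hv => hu.add hv
      zero_mem' := inDomain_zero γ b
      smul_mem' := fun c _ hu => hu.smul c }
  toFun :=
    { toFun := fun u => u.2.exists_value.choose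
      map_add' := fun u v => by
        apply Subtype.ext
        ext x
        refine ((u + v).2.exists_value.choose_spec x).trans ?_
        refine (diffExpr_add γ b u.2.1 v.2.1 u.2.2 v.2.2 x.2).trans ?_
        exact (congrArg₂ (· + ·) (u.2.exists_value.choose_spec x)
          (v.2.exists_value.choose_spec x)).symm
      map_smul' := fun c u => by
        apply Subtype.ext
        ext x
        refine ((c • u).2.exists_value.choose_spec x).trans ?_
        refine (diffExpr_smul γ b u.2.1 u.2.2 c x.2).trans ?_
        exact (congrArg (c • ·) (u.2.exists_value.choose_spec x)).symm }

theorem mem_opA_domain {γ b : ℝ} {u : CInfty 𝕜} : u ∈ (opA 𝕜 γ b).domain ↔ InDomain γ b u :=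
  Iff.rfl

theorem opA_apply {γ b : ℝ} (u : (opA 𝕜 γ b).domain) (x : ℝ≥0) :
    (opA 𝕜 γ b u).1 x = diffExpr γ b (onReal u) x :=
  InDomain.exists_value u.2 |>.choose_spec x

end HalfLine

namespace Unbounded

variable {𝕜 E : Type*} [NontriviallyNormedField 𝕜] [NormedAddCommGroup E] [NormedSpace 𝕜 E]

/-- `R` is a bounded everywhere defined two-sided inverse of `z - A : D(A) → E`. -/
def IsResolventAt (A : E →ₗ.[𝕜] E) (z : 𝕜) (R : E →L[𝕜] E) : Prop :=
  (∀ f : E, ∃ h : R f ∈ A.domain, z • R f - A ⟨R f, h⟩ = f) ∧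
    ∀ u : A.domain, R (z • (u : E) - A u) = u

/-- The resolvent set of an unbounded operator. -/
def resolventSet (A : E →ₗ.[𝕜] E) : Set 𝕜 := {z | ∃ R : E →L[𝕜] E, IsResolventAt A z R}

open Classical in
/-- The resolvent `R(z, A) = (z - A)⁻¹` (for `z` in the resolvent set; otherwise `0`). -/
def resolvent (z : 𝕜) (A : E →ₗ.[𝕜] E) : E →L[𝕜] E :=
  if h : ∃ R : E →L[𝕜] E, IsResolventAt A z R then h.choose else 0

theorem resolvent_spec {A : E →ₗ.[𝕜] E} {z : 𝕜} (hz : z ∈ resolventSet A) :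
    IsResolventAt A z (resolvent z A) := by
  have h : ∃ R : E →L[𝕜] E, IsResolventAt A z R := hz
  rw [resolvent, dif_pos h]
  exact h.choose_spec

end Unbounded

end

namespace HalfLine

variable {𝕜 : Type*} [RCLike 𝕜]

/-! Write $w=u'$. The equation $\lambda u-Au=f$ becomes the first-order equation $\gamma x
w'+bw=\lambda u-f$, and two maximum principles give the estimate. First, where $|u|$ is maximal $Au$
points inwards, and $Au\to0$ at infinity, so $\lambda\|u\|\le\|f\|$ (`InDomain.norm_le`). Second,
where $|w|$ is maximal the term $xw'$ has no component along $w$, so $b|w|\le|\lambda u-f|\le2\|f\|$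
(`norm_snd_le_of_mem`). Hence $\|u'\|\le 2\|f\|/b$, which gives the claim with $C=2$.

Existence follows from the same estimates. The triples $(u,u',f)$ form a closed space on which $f$
controls the whole triple, so the set of solvable $f$ is closed. It is also dense: for $f=e^{-sx}$
the semigroup is explicit and its Laplace transform is a solution (`exists_solution_exp`), and
polynomials in $e^{-x}$ are dense by Weierstrass. The condition $w\to0$ at infinity, needed for the
second estimate, is built into the triples; uniqueness in the full domain uses only the first
estimate. -/

/-! ### Completeness of $C([0,\infty])$ and its basic functionals. -/

theorem continuous_onReal (u : CInfty 𝕜) : Continuous (onReal u) :=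
  u.1.continuous.comp continuous_real_toNNReal

theorem norm_onReal_le (u : CInfty 𝕜) (x : ℝ) : ‖onReal u x‖ ≤ ‖u‖ :=
  u.1.norm_coe_le_norm _

theorem norm_le_of_forall {u : CInfty 𝕜} {M : ℝ} (hM : 0 ≤ M)
    (h : ∀ x : ℝ, 0 ≤ x → ‖onReal u x‖ ≤ M) : ‖u‖ ≤ M :=
  (BoundedContinuousFunction.norm_le hM).2 fun x => by
    simpa [onReal] using h x x.2

theorem ext_onReal {u v : CInfty 𝕜} (h : ∀ x : ℝ, 0 ≤ x → onReal u x = onReal v x) : u = v := by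
  apply Subtype.ext
  ext x
  simpa [onReal] using h x x.2

theorem exists_tendsto_onReal (u : CInfty 𝕜) : ∃ l : 𝕜, Tendsto (onReal u) atTop (𝓝 l) := by
  obtain ⟨l, hl⟩ := u.2
  exact ⟨l, hl.comp tendsto_real_toNNReal_atTop⟩

/-- A continuous function on `[0,∞)` with a limit at infinity, as an element of `C([0,∞])`. -/
theorem exists_onReal_eq (g : ℝ → 𝕜) (hg : ContinuousOn g (Ici 0)) (l : 𝕜)
    (hl : Tendsto g atTop (𝓝 l)) :
    ∃ v : CInfty 𝕜, ∀ x : ℝ, 0 ≤ x → onReal v x = g x := by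
  obtain ⟨v, hv⟩ := exists_mem_CInfty g hg l hl
  refine ⟨v, fun x hx => ?_⟩
  rw [onReal, hv, Real.coe_toNNReal x hx]

/-- The uniform limit is Cauchy along `atTop`: two approximation errors and two distances to the
limit of `f n`, each below `ε / 4`, add up to less than `ε`. -/
theorem isClosed_CInfty : IsClosed (CInfty 𝕜 : Set (ℝ≥0 →ᵇ 𝕜)) := by
  rw [← isSeqClosed_iff_isClosed]
  intro f g hf hg
  choose l hl using hf
  have hu : TendstoUniformly (fun n x => f n x) g atTop :=
    BoundedContinuousFunction.tendsto_iff_tendstoUniformly.1 hg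
  have hc : Cauchy (map (fun x : ℝ≥0 => g x) atTop) := by
    rw [Metric.cauchy_iff]
    refine ⟨inferInstance, fun ε hε => ?_⟩
    obtain ⟨n, hn⟩ := (Metric.tendstoUniformly_iff.1 hu (ε / 4) (by linarith)).exists
    have h1 : ∀ᶠ x : ℝ≥0 in atTop, dist (f n x) (l n) < ε / 4 :=
      Metric.tendsto_nhds.1 (hl n) _ (by linarith)
    refine ⟨_, image_mem_map h1, ?_⟩
    rintro _ ⟨x, hx, rfl⟩ _ ⟨y, hy, rfl⟩
    have hx : dist (f n x) (l n) < ε / 4 := hx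
    have hy : dist (f n y) (l n) < ε / 4 := hy
    have a := dist_triangle4 (g x) (f n x) (f n y) (g y)
    have b := dist_triangle_right (f n x) (f n y) (l n)
    have c := hn x
    have d := hn y
    rw [dist_comm (g y)] at d
    linarith
  obtain ⟨m, hm⟩ := CompleteSpace.complete hc
  exact ⟨m, hm⟩

instance : CompleteSpace (CInfty 𝕜) := isClosed_CInfty.completeSpace_coe

variable (𝕜) in
/-- Evaluation at a point of the half-line. -/
noncomputable def evalCLM (x : ℝ) : CInfty 𝕜 →L[𝕜] 𝕜 :=
  LinearMap.mkContinuous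
    { toFun := fun u => onReal u x
      map_add' := fun _ _ => rfl
      map_smul' := fun _ _ => rfl } 1 fun u => (norm_onReal_le u x).trans_eq (one_mul _).symm

variable (𝕜) in
/-- The limit at infinity. -/
noncomputable def limCLM : CInfty 𝕜 →L[𝕜] 𝕜 :=
  LinearMap.mkContinuous
    { toFun := fun u => (exists_tendsto_onReal u).choose
      map_add' := fun u v => tendsto_nhds_unique (exists_tendsto_onReal (u + v)).choose_spec
        ((exists_tendsto_onReal u).choose_spec.add (exists_tendsto_onReal v).choose_spec)
      map_smul' := fun c u => tendsto_nhds_unique (exists_tendsto_onReal (c • u)).choose_spec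
        ((exists_tendsto_onReal u).choose_spec.const_smul c) } 1 fun u => by
    rw [one_mul]
    exact le_of_tendsto (exists_tendsto_onReal u).choose_spec.norm
      (Eventually.of_forall (norm_onReal_le u))

theorem tendsto_limCLM (u : CInfty 𝕜) : Tendsto (onReal u) atTop (𝓝 (limCLM 𝕜 u)) :=
  (exists_tendsto_onReal u).choose_spec

theorem limCLM_eq {u : CInfty 𝕜} {l : 𝕜} (h : Tendsto (onReal u) atTop (𝓝 l)) :
    limCLM 𝕜 u = l :=
  tendsto_nhds_unique (tendsto_limCLM u) h

variable (𝕜) in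
/-- The integral over `[0, x]`. -/
noncomputable def integralCLM (x : ℝ) : CInfty 𝕜 →L[𝕜] 𝕜 :=
  LinearMap.mkContinuous
    { toFun := fun u => ∫ t in (0 : ℝ)..x, onReal u t
      map_add' := fun u v => intervalIntegral.integral_add
        ((continuous_onReal u).intervalIntegrable _ _) ((continuous_onReal v).intervalIntegrable _ _)
      map_smul' := fun c u => intervalIntegral.integral_smul c (onReal u) } |x| fun u => by
    have h := intervalIntegral.norm_integral_le_of_norm_le_const (a := 0) (b := x) (f := onReal u)
      (fun t _ => norm_onReal_le u t)
    rw [sub_zero, mul_comm] at h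
    exact h

theorem integralCLM_apply (x : ℝ) (u : CInfty 𝕜) :
    integralCLM 𝕜 x u = ∫ t in (0 : ℝ)..x, onReal u t := rfl

theorem hasDerivAt_integralCLM (u : CInfty 𝕜) (x : ℝ) :
    HasDerivAt (fun y => integralCLM 𝕜 y u) (onReal u x) x :=
  ((continuous_onReal u).integral_hasStrictDerivAt 0 x).hasDerivAt

/-! ### Maximum principle. -/

/-- To bound the sup-norm it suffices to bound the limit at infinity and the value at a point where
the modulus is maximal. -/
theorem norm_le_of_isMax {u : CInfty 𝕜} {M : ℝ} (hM : 0 ≤ M) (hl : ‖limCLM 𝕜 u‖ ≤ M)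
    (h : ∀ x : ℝ, 0 ≤ x → (∀ y : ℝ, ‖onReal u y‖ ≤ ‖onReal u x‖) → ‖onReal u x‖ ≤ M) :
    ‖u‖ ≤ M := by
  refine norm_le_of_forall hM fun x hx => ?_
  by_contra! hx1
  have h1 : ∀ᶠ y : ℝ in atTop, ‖onReal u y‖ < ‖onReal u x‖ :=
    (tendsto_limCLM u).norm.eventually_lt_const (hl.trans_lt hx1)
  have h2 : ∀ᶠ y : ℝ≥0 in cocompact ℝ≥0, ‖onReal u y‖ ≤ ‖onReal u x.toNNReal‖ := by
    rw [cocompact_eq_atTop, Real.coe_toNNReal x hx]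
    exact ((NNReal.tendsto_coe_atTop.2 tendsto_id).eventually h1).mono fun _ => le_of_lt
  obtain ⟨z, hz⟩ := Continuous.exists_forall_ge' (f := fun y : ℝ≥0 => ‖onReal u y‖)
    ((continuous_onReal u).norm.comp NNReal.continuous_coe) _ h2
  have h3 : ∀ y : ℝ, ‖onReal u y‖ ≤ ‖onReal u z‖ := fun y => by
    have h4 := hz y.toNNReal
    simp only [onReal, Real.toNNReal_coe] at h4 ⊢
    exact h4
  exact absurd ((h3 x).trans (h z z.2 h3)) hx1.not_ge

/-- The real-linear functional `z ↦ Re (conj a * z)`. -/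
noncomputable def reMulConj (a : 𝕜) : 𝕜 →L[ℝ] ℝ :=
  RCLike.reCLM.comp (ContinuousLinearMap.mul ℝ 𝕜 (starRingEnd 𝕜 a))

theorem reMulConj_apply (a z : 𝕜) : reMulConj a z = RCLike.re (starRingEnd 𝕜 a * z) := rfl

theorem reMulConj_self (a : 𝕜) : reMulConj a a = ‖a‖ ^ 2 := by
  rw [reMulConj_apply, RCLike.conj_mul]
  norm_cast

theorem reMulConj_le (a z : 𝕜) : reMulConj a z ≤ ‖a‖ * ‖z‖ := by
  rw [reMulConj_apply]
  refine (RCLike.re_le_norm _).trans ?_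
  rw [norm_mul, RCLike.norm_conj]

/-- Turns a maximum of the modulus of a `𝕜`-valued function into a maximum of a real function, to
which the real derivative tests apply. -/
theorem reMulConj_le_self {a z : 𝕜} (h : ‖z‖ ≤ ‖a‖) : reMulConj a z ≤ reMulConj a a := by
  rw [reMulConj_self, sq]
  exact (reMulConj_le a z).trans (mul_le_mul_of_nonneg_left h (norm_nonneg _))

theorem mul_norm_le_of_reMulConj {a z : 𝕜} {c : ℝ}
    (h : c * reMulConj a a ≤ reMulConj a z) : c * ‖a‖ ≤ ‖z‖ := by
  rcases eq_or_ne a 0 with rfl | ha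
  · simp
  have ha : 0 < ‖a‖ := norm_pos_iff.2 ha
  have h1 := h.trans (reMulConj_le a z)
  rw [reMulConj_self] at h1
  refine le_of_mul_le_mul_left ?_ ha
  linarith

/-- Were the second derivative positive, the point would also be a local minimum, so `f` would be
locally constant with zero second derivative. -/
theorem deriv_deriv_nonpos_of_isLocalMax {f : ℝ → ℝ} {x : ℝ} (h : IsLocalMax f x)
    (hc : ContinuousAt f x) : deriv (deriv f) x ≤ 0 := by
  by_contra! h1
  have h2 : IsLocalMin f x := isLocalMin_of_deriv_deriv_pos h1 h.deriv_eq_zero hc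
  have h3 : f =ᶠ[𝓝 x] fun _ => f x := by
    filter_upwards [h, h2] with y hy hy2 using le_antisymm hy hy2
  have h4 : deriv (deriv f) x = 0 := by
    rw [h3.deriv.deriv_eq]
    simp
  exact h1.ne' h4

theorem hasDerivWithinAt_Ici_nonpos {f : ℝ → ℝ} {f' x : ℝ} (h : HasDerivWithinAt f f' (Ici x) x)
    (hm : ∀ y, x ≤ y → f y ≤ f x) : f' ≤ 0 := by
  rw [← hasDerivWithinAt_Ioi_iff_Ici, hasDerivWithinAt_iff_tendsto_slope' (by simp)] at h
  refine le_of_tendsto h ?_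
  filter_upwards [self_mem_nhdsWithin] with y hy
  rw [slope_def_field]
  exact div_nonpos_of_nonpos_of_nonneg (by linarith [hm y (le_of_lt hy)]) (by
    have : x < y := hy
    linarith)

theorem InDomain.hasDerivWithinAt {γ b : ℝ} {u : CInfty 𝕜} (hu : InDomain γ b u) {x : ℝ}
    (hx : 0 ≤ x) :
    HasDerivWithinAt (onReal u) (derivWithin (onReal u) (Ici 0) x) (Ici 0) x :=
  ((hu.1.differentiableOn (by norm_num)) x hx).hasDerivWithinAt

/-- At a point where `‖u‖` is maximal, `γ x u'' + b u'` points inwards. -/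
theorem InDomain.reMulConj_diffExpr_nonpos {γ b : ℝ} (hγ : 0 < γ) (hb : 0 < b) {u : CInfty 𝕜}
    (hu : InDomain γ b u) {x : ℝ} (hx : 0 ≤ x) (hm : ∀ y : ℝ, ‖onReal u y‖ ≤ ‖onReal u x‖) :
    reMulConj (onReal u x) (diffExpr γ b (onReal u) x) ≤ 0 := by
  set L := reMulConj (onReal u x) with hL
  have hmax : ∀ y, L (onReal u y) ≤ L (onReal u x) := fun y => reMulConj_le_self (hm y)
  have hd := L.hasFDerivAt.comp_hasDerivWithinAt x (hu.hasDerivWithinAt hx)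
  rw [diffExpr, map_add, map_smul, map_smul]
  rcases hx.eq_or_lt with rfl | h0
  -- At the end point the factor $x$ removes the second-order term, and the one-sided derivative is
  -- nonpositive in the direction of $u(0)$.
  · have h1 := hasDerivWithinAt_Ici_nonpos hd fun y _ => hmax y
    simpa using mul_nonpos_of_nonneg_of_nonpos hb.le h1
  · have hloc : IsLocalMax (fun y => L (onReal u y)) x := Eventually.of_forall hmax
    have h1 : L (derivWithin (onReal u) (Ici 0) x) = 0 :=
      hloc.hasDerivAt_eq_zero (hd.hasDerivAt (Ici_mem_nhds h0))
    have h2 := deriv_deriv_nonpos_of_isLocalMax hloc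
      (L.continuous.comp (continuous_onReal u)).continuousAt
    have h3 : deriv (fun y => L (onReal u y)) =ᶠ[𝓝 x] fun y => L (deriv (onReal u) y) := by
      filter_upwards [Ioi_mem_nhds h0] with y hy
      exact (L.hasFDerivAt.comp_hasDerivAt y (differentiableAt_of_Ioi hu.2 hy).hasDerivAt).deriv
    have h4 : deriv (deriv (fun y => L (onReal u y))) x = L (deriv (deriv (onReal u)) x) := by
      rw [h3.deriv_eq]
      exact (L.hasFDerivAt.comp_hasDerivAt x (differentiableAt_deriv hu.2 h0).hasDerivAt).deriv
    rw [h4] at h2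
    rw [h1, smul_zero, add_zero]
    exact mul_nonpos_of_nonneg_of_nonpos (by positivity) h2

/-- The maximum principle: `λ ‖u‖ ≤ ‖λ u - A u‖`. -/
theorem InDomain.norm_le {γ b lam : ℝ} (hγ : 0 < γ) (hb : 0 < b) (hlam : 0 < lam)
    {u f : CInfty 𝕜} (hu : InDomain γ b u)
    (hf : ∀ x : ℝ, 0 ≤ x → lam • onReal u x - diffExpr γ b (onReal u) x = onReal f x) :
    ‖u‖ ≤ ‖f‖ / lam := by
  refine norm_le_of_isMax (by positivity) ?_ fun x hx hm => ?_
  -- Since $Au\to0$, the limits at infinity satisfy $\lambda u(\infty)=f(\infty)$.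
  · have h1 : Tendsto (onReal f) atTop (𝓝 (lam • limCLM 𝕜 u - 0)) := by
      refine (((tendsto_limCLM u).const_smul lam).sub hu.4).congr' ?_
      filter_upwards [Ici_mem_atTop (0 : ℝ)] with x hx using hf x hx
    have h2 := le_of_tendsto h1.norm (Eventually.of_forall (norm_onReal_le f))
    rw [sub_zero, norm_smul, Real.norm_of_nonneg hlam.le] at h2
    rwa [le_div_iff₀' hlam]
  · rw [le_div_iff₀' hlam]
    refine le_trans (mul_norm_le_of_reMulConj ?_) (norm_onReal_le f x)
    rw [← hf x hx, map_sub, map_smul]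
    simpa using hu.reMulConj_diffExpr_nonpos hγ hb hx hm

/-! ### The closed space of solution triples. -/

variable (𝕜) in
/-- The map `(u, w, f) ↦ λ u - f`. -/
noncomputable def rhsCLM (lam : ℝ) : CInfty 𝕜 × CInfty 𝕜 × CInfty 𝕜 →L[𝕜] CInfty 𝕜 :=
  (lam : 𝕜) • ContinuousLinearMap.fst 𝕜 _ _ -
    (ContinuousLinearMap.snd 𝕜 _ _).comp (ContinuousLinearMap.snd 𝕜 _ _)

variable (𝕜) in
/-- The map `(u, w, f) ↦ w`. -/
noncomputable def midCLM : CInfty 𝕜 × CInfty 𝕜 × CInfty 𝕜 →L[𝕜] CInfty 𝕜 :=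
  (ContinuousLinearMap.fst 𝕜 _ _).comp (ContinuousLinearMap.snd 𝕜 _ _)

variable (𝕜) in
/-- The triples `(u, w, f)` with `w = u'` and `λ u - A u = f`, described by the integrated equations
`u(x) = u(0) + ∫₀ˣ w` and `γ x w(x) = ∫₀ˣ (γ w + λ u - f - b w)` and boundary conditions. -/
noncomputable def solutionSpace (γ b lam : ℝ) : Submodule 𝕜 (CInfty 𝕜 × CInfty 𝕜 × CInfty 𝕜) :=
  (⨅ x : ℝ≥0,
    ((evalCLM 𝕜 x - evalCLM 𝕜 0).comp (ContinuousLinearMap.fst 𝕜 _ _) -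
      (integralCLM 𝕜 x).comp (midCLM 𝕜)).ker ⊓
    (((γ * x : ℝ) : 𝕜) • (evalCLM 𝕜 x).comp (midCLM 𝕜) -
      (integralCLM 𝕜 x).comp ((γ : 𝕜) • midCLM 𝕜 + rhsCLM 𝕜 lam - (b : 𝕜) • midCLM 𝕜)).ker) ⊓
  -- The condition at $0$ encodes $xu''\to0$; those at infinity are $u'\to0$ and $Au\to0$.
  ((evalCLM 𝕜 0).comp (rhsCLM 𝕜 lam - (b : 𝕜) • midCLM 𝕜)).ker ⊓
  ((limCLM 𝕜).comp (midCLM 𝕜)).ker ⊓ ((limCLM 𝕜).comp (rhsCLM 𝕜 lam)).ker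

theorem isClosed_solutionSpace (γ b lam : ℝ) :
    IsClosed (solutionSpace 𝕜 γ b lam : Set (CInfty 𝕜 × CInfty 𝕜 × CInfty 𝕜)) := by
  simp only [solutionSpace, Submodule.coe_inf, Submodule.coe_iInf]
  refine ((IsClosed.inter (isClosed_iInter fun x => ?_) ?_).inter ?_).inter ?_
  · exact (ContinuousLinearMap.isClosed_ker _).inter (ContinuousLinearMap.isClosed_ker _)
  all_goals exact ContinuousLinearMap.isClosed_ker _

theorem mem_solutionSpace {γ b lam : ℝ} {u w f : CInfty 𝕜} :
    (u, w, f) ∈ solutionSpace 𝕜 γ b lam ↔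
      (∀ x : ℝ, 0 ≤ x → onReal u x = onReal u 0 + integralCLM 𝕜 x w) ∧
      (∀ x : ℝ, 0 ≤ x → (γ * x) • onReal w x =
        integralCLM 𝕜 x ((γ : 𝕜) • w + ((lam : 𝕜) • u - f) - (b : 𝕜) • w)) ∧
      lam • onReal u 0 - onReal f 0 - b • onReal w 0 = 0 ∧
      Tendsto (onReal w) atTop (𝓝 0) ∧
      Tendsto (onReal ((lam : 𝕜) • u - f)) atTop (𝓝 0) := by
  have hlim : ∀ v : CInfty 𝕜, limCLM 𝕜 v = 0 ↔ Tendsto (onReal v) atTop (𝓝 0) := fun v =>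
    ⟨fun h => h ▸ tendsto_limCLM v, limCLM_eq⟩
  have h1 : (u, w, f) ∈ solutionSpace 𝕜 γ b lam ↔
      (((∀ x : ℝ≥0, (onReal u x - onReal u 0 - integralCLM 𝕜 x w = 0 ∧
      ((γ * x : ℝ) : 𝕜) • onReal w x -
        integralCLM 𝕜 x ((γ : 𝕜) • w + ((lam : 𝕜) • u - f) - (b : 𝕜) • w) = 0)) ∧
      (lam : 𝕜) • onReal u 0 - onReal f 0 - (b : 𝕜) • onReal w 0 = 0) ∧
      limCLM 𝕜 w = 0) ∧ limCLM 𝕜 ((lam : 𝕜) • u - f) = 0 := by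
    simp only [solutionSpace, Submodule.mem_inf, Submodule.mem_iInf]
    rfl
  rw [h1, hlim, hlim, and_assoc, and_assoc, forall_and, and_assoc]
  simp only [← RCLike.real_smul_eq_coe_smul (K := 𝕜), NNReal.forall, NNReal.coe_mk,
    sub_sub, sub_eq_zero]

section SolutionSpace

variable {γ b lam : ℝ} {u w f : CInfty 𝕜}

theorem hasDerivWithinAt_of_mem (h : (u, w, f) ∈ solutionSpace 𝕜 γ b lam) {x : ℝ} (hx : 0 ≤ x) :
    HasDerivWithinAt (onReal u) (onReal w x) (Ici 0) x :=
  ((hasDerivAt_integralCLM w x).const_add (onReal u 0)).hasDerivWithinAt.congr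
    (mem_solutionSpace.1 h).1 ((mem_solutionSpace.1 h).1 x hx)

theorem hasDerivAt_of_mem (h : (u, w, f) ∈ solutionSpace 𝕜 γ b lam) {x : ℝ} (hx : 0 < x) :
    HasDerivAt (onReal u) (onReal w x) x :=
  (hasDerivWithinAt_of_mem h hx.le).hasDerivAt (Ici_mem_nhds hx)

/-- Divide the integrated equation by $\gamma x$ and differentiate: the derivative of $1/(\gamma x)$
cancels the term $\gamma w$ in the integrand. -/
theorem hasDerivAt_snd_of_mem (hγ : 0 < γ) (h : (u, w, f) ∈ solutionSpace 𝕜 γ b lam) {x : ℝ}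
    (hx : 0 < x) :
    HasDerivAt (onReal w)
      ((γ * x)⁻¹ • (lam • onReal u x - onReal f x - b • onReal w x)) x := by
  set q := (γ : 𝕜) • w + ((lam : 𝕜) • u - f) - (b : 𝕜) • w with hq
  have hqx : onReal q x = γ • onReal w x + (lam • onReal u x - onReal f x) - b • onReal w x := by
    simp only [RCLike.real_smul_eq_coe_smul (K := 𝕜)]
    rfl
  have h1 : onReal w =ᶠ[𝓝 x] fun y => (γ * y)⁻¹ • integralCLM 𝕜 y q := by
    filter_upwards [Ioi_mem_nhds hx] with y hy
    have hy : 0 < y := hy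
    rw [← (mem_solutionSpace.1 h).2.1 y hy.le, inv_smul_smul₀ (by positivity)]
  have h2 : HasDerivAt (fun y : ℝ => (γ * y)⁻¹) (-γ / (γ * x) ^ 2) x := by
    simpa using ((hasDerivAt_id x).const_mul γ).fun_inv (by simp; constructor <;> positivity)
  refine ((h2.smul (hasDerivAt_integralCLM q x)).congr_of_eventuallyEq h1).congr_deriv ?_
  rw [← (mem_solutionSpace.1 h).2.1 x hx.le, hqx, smul_smul]
  have h3 : -γ / (γ * x) ^ 2 * (γ * x) = -((γ * x)⁻¹ * γ) := by
    field_simp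
  rw [h3]
  module

theorem derivWithin_of_mem (h : (u, w, f) ∈ solutionSpace 𝕜 γ b lam) {x : ℝ} (hx : 0 ≤ x) :
    derivWithin (onReal u) (Ici 0) x = onReal w x :=
  (hasDerivWithinAt_of_mem h hx).derivWithin (uniqueDiffOn_Ici 0 x hx)

theorem deriv_deriv_of_mem (hγ : 0 < γ) (h : (u, w, f) ∈ solutionSpace 𝕜 γ b lam) {x : ℝ}
    (hx : 0 < x) : deriv (deriv (onReal u)) x =
      (γ * x)⁻¹ • (lam • onReal u x - onReal f x - b • onReal w x) := by
  have h1 : deriv (onReal u) =ᶠ[𝓝 x] onReal w := by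
    filter_upwards [Ioi_mem_nhds hx] with y hy using (hasDerivAt_of_mem h hy).deriv
  rw [h1.deriv_eq, (hasDerivAt_snd_of_mem hγ h hx).deriv]

theorem diffExpr_of_mem (hγ : 0 < γ) (h : (u, w, f) ∈ solutionSpace 𝕜 γ b lam) {x : ℝ}
    (hx : 0 ≤ x) : diffExpr γ b (onReal u) x = lam • onReal u x - onReal f x := by
  rw [diffExpr, derivWithin_of_mem h hx]
  rcases hx.eq_or_lt with rfl | h0
  · have h3 := (mem_solutionSpace.1 h).2.2.1
    rw [sub_eq_zero] at h3
    simp [← h3]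
  · rw [deriv_deriv_of_mem hγ h h0, smul_inv_smul₀ (by positivity)]
    abel

theorem continuous_residual (u w f : CInfty 𝕜) (b lam : ℝ) :
    Continuous fun x => lam • onReal u x - onReal f x - b • onReal w x :=
  (((continuous_onReal u).const_smul lam).sub (continuous_onReal f)).sub
    ((continuous_onReal w).const_smul b)

theorem inDomain_of_mem (hγ : 0 < γ) (h : (u, w, f) ∈ solutionSpace 𝕜 γ b lam) :
    InDomain γ b u where
  contDiffOn_one := by
    rw [contDiffOn_one_iff_derivWithin (uniqueDiffOn_Ici 0)]
    exact ⟨fun x hx => (hasDerivWithinAt_of_mem h hx).differentiableWithinAt,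
      (continuous_onReal w).continuousOn.congr fun x hx => derivWithin_of_mem h hx⟩
  contDiffOn_two := by
    have h2 : ContDiffOn ℝ 1 (onReal w) (Ioi 0) := by
      rw [contDiffOn_one_iff_derivWithin isOpen_Ioi.uniqueDiffOn]
      refine ⟨fun x hx => (hasDerivAt_snd_of_mem hγ h hx).differentiableAt.differentiableWithinAt,
        ContinuousOn.congr (f := fun x => (γ * x)⁻¹ •
          (lam • onReal u x - onReal f x - b • onReal w x)) ?_ fun x hx => ?_⟩
      · refine ContinuousOn.smul (ContinuousOn.inv₀ (by fun_prop) fun x hx => ?_)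
          (continuous_residual u w f b lam).continuousOn
        exact (mul_pos hγ hx).ne'
      · exact (hasDerivAt_snd_of_mem hγ h hx).hasDerivWithinAt.derivWithin
          (isOpen_Ioi.uniqueDiffOn x hx)
    rw [show (2 : WithTop ℕ∞) = 1 + 1 by norm_num, contDiffOn_succ_iff_deriv_of_isOpen isOpen_Ioi]
    exact ⟨fun x hx => (hasDerivAt_of_mem h hx).differentiableAt.differentiableWithinAt, by simp,
      h2.congr fun x hx => (hasDerivAt_of_mem h hx).deriv⟩
  tendsto_zero := by
    -- Here $\gamma xu''=\lambda u-f-bw$ is continuous up to $0$ and vanishes there.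
    have h3 := ((continuous_residual u w f b lam).tendsto 0).mono_left
      (nhdsWithin_le_nhds (s := Ioi (0 : ℝ)))
    rw [(mem_solutionSpace.1 h).2.2.1] at h3
    have h4 := h3.const_smul γ⁻¹
    rw [smul_zero] at h4
    refine h4.congr' ?_
    filter_upwards [self_mem_nhdsWithin] with x hx
    have hx : 0 < x := hx
    rw [deriv_deriv_of_mem hγ h hx, smul_smul]
    congr 1
    field_simp
  tendsto_infty := by
    refine (mem_solutionSpace.1 h).2.2.2.2.congr' ?_
    filter_upwards [Ici_mem_atTop (0 : ℝ)] with x hx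
    rw [diffExpr_of_mem hγ h hx, RCLike.real_smul_eq_coe_smul (K := 𝕜)]
    rfl

theorem norm_fst_le_of_mem (hγ : 0 < γ) (hb : 0 < b) (hlam : 0 < lam)
    (h : (u, w, f) ∈ solutionSpace 𝕜 γ b lam) : ‖u‖ ≤ ‖f‖ / lam :=
  (inDomain_of_mem hγ h).norm_le hγ hb hlam fun x hx => by
    rw [diffExpr_of_mem hγ h hx, sub_sub_cancel]

/-- Dividing by $b$ instead of integrating the first-order equation is possible because, at a
maximum of $|w|$, $xw'$ drops out after pairing with $w$; at $0$ the boundary condition removes it.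
-/
theorem norm_snd_le_of_mem (hγ : 0 < γ) (hb : 0 < b) (hlam : 0 < lam)
    (h : (u, w, f) ∈ solutionSpace 𝕜 γ b lam) : ‖w‖ ≤ 2 * ‖f‖ / b := by
  have hu : lam * ‖u‖ ≤ ‖f‖ := by
    have := norm_fst_le_of_mem hγ hb hlam h
    rwa [le_div_iff₀' hlam] at this
  refine norm_le_of_isMax (by positivity) ?_ fun x hx hm => ?_
  · rw [limCLM_eq (mem_solutionSpace.1 h).2.2.2.1, norm_zero]
    positivity
  have key : b * reMulConj (onReal w x) (onReal w x) ≤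
      reMulConj (onReal w x) (lam • onReal u x - onReal f x) := by
    rcases hx.eq_or_lt with rfl | h0
    · have h3 := (mem_solutionSpace.1 h).2.2.1
      rw [sub_eq_zero] at h3
      rw [h3, map_smul, smul_eq_mul]
    · set L := reMulConj (onReal w x) with hL
      have hloc : IsLocalMax (fun y => L (onReal w y)) x :=
        Eventually.of_forall fun y => reMulConj_le_self (hm y)
      have h1 := hloc.hasDerivAt_eq_zero
        (L.hasFDerivAt.comp_hasDerivAt x (hasDerivAt_snd_of_mem hγ h h0))
      rw [map_smul, smul_eq_zero, or_iff_right (by positivity), map_sub _ _ (b • _), map_smul,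
        smul_eq_mul, sub_eq_zero] at h1
      exact h1.ge
  rw [le_div_iff₀' hb]
  refine (mul_norm_le_of_reMulConj key).trans ((norm_sub_le _ _).trans ?_)
  rw [norm_smul, Real.norm_of_nonneg hlam.le]
  have := mul_le_mul_of_nonneg_left (norm_onReal_le u x) hlam.le
  linarith [norm_onReal_le f x]

end SolutionSpace

/-! ### Laplace-type integrals with bounded positive rates. -/

section LaplaceKernel

open MeasureTheory

variable {α : Type*} [MeasurableSpace α] {μ : Measure α} {K a : α → ℝ} {s : ℝ}

theorem exp_neg_mul_le {c s x r : ℝ} (h0 : 0 ≤ c) (hs : c ≤ s) (hx : |x| ≤ r) :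
    Real.exp (-(c * x)) ≤ Real.exp (s * r) := by
  refine Real.exp_le_exp.2 ((neg_le_abs _).trans ?_)
  rw [abs_mul, abs_of_nonneg h0]
  exact mul_le_mul hs hx (abs_nonneg x) (h0.trans hs)

theorem integrable_mul_exp (hK : Integrable K μ) (ha : AEStronglyMeasurable a μ)
    (h : ∀ᵐ t ∂μ, 0 < a t ∧ a t ≤ s) (x : ℝ) :
    Integrable (fun t => K t * Real.exp (-(a t * x))) μ := by
  refine hK.mul_bdd (c := Real.exp (s * |x|))
    (Real.continuous_exp.comp_aestronglyMeasurable (ha.mul_const x).neg) ?_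
  filter_upwards [h] with t ht
  rw [Real.norm_of_nonneg (Real.exp_pos _).le]
  exact exp_neg_mul_le ht.1.le ht.2 le_rfl

/-- Makes `K * a` an admissible kernel again, so differentiation under the integral can be iterated.
-/
theorem integrable_mul_rate (hK : Integrable K μ) (ha : AEStronglyMeasurable a μ)
    (h : ∀ᵐ t ∂μ, 0 < a t ∧ a t ≤ s) : Integrable (fun t => K t * a t) μ := by
  refine hK.mul_bdd (c := s) ha ?_
  filter_upwards [h] with t ht
  rw [Real.norm_of_nonneg ht.1.le]
  exact ht.2

/-- Bounded rates give the dominating function $|Ka|e^{s(|x|+1)}$ on the unit ball about any real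
$x$, negative ones included; no one-sided derivative at $0$ is needed. -/
theorem hasDerivAt_integral_mul_exp (hK : Integrable K μ) (ha : AEStronglyMeasurable a μ)
    (h : ∀ᵐ t ∂μ, 0 < a t ∧ a t ≤ s) (x : ℝ) :
    HasDerivAt (fun x => ∫ t, K t * Real.exp (-(a t * x)) ∂μ)
      (-∫ t, K t * a t * Real.exp (-(a t * x)) ∂μ) x := by
  have hKa := integrable_mul_rate hK ha h
  rw [← integral_neg]
  refine (hasDerivAt_integral_of_dominated_loc_of_deriv_le (𝕜 := ℝ)
    (F' := fun x t => -(K t * a t * Real.exp (-(a t * x))))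
    (bound := fun t => |K t * a t| * Real.exp (s * (|x| + 1)))
    (Metric.ball_mem_nhds x one_pos)
    (Eventually.of_forall fun y => (integrable_mul_exp hK ha h y).aestronglyMeasurable)
    (integrable_mul_exp hK ha h x) (integrable_mul_exp hKa ha h x).aestronglyMeasurable.neg
    ?_ (hKa.abs.mul_const _) ?_).2
  · filter_upwards [h] with t ht y hy
    rw [norm_neg, norm_mul, Real.norm_eq_abs, Real.norm_of_nonneg (Real.exp_pos _).le]
    refine mul_le_mul_of_nonneg_left (exp_neg_mul_le ht.1.le ht.2 ?_) (abs_nonneg _)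
    rw [Metric.mem_ball, Real.dist_eq] at hy
    have := abs_sub_abs_le_abs_sub y x
    linarith
  · filter_upwards with t y _
    have h1 : HasDerivAt (fun y : ℝ => -(a t * y)) (-(a t * 1)) y :=
      ((hasDerivAt_id y).const_mul (a t)).neg
    exact (h1.exp.const_mul (K t)).congr_deriv (by ring)

theorem tendsto_integral_mul_exp (hK : Integrable K μ) (ha : AEStronglyMeasurable a μ)
    (h : ∀ᵐ t ∂μ, 0 < a t ∧ a t ≤ s) :
    Tendsto (fun x => ∫ t, K t * Real.exp (-(a t * x)) ∂μ) atTop (𝓝 0) := by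
  rw [← integral_zero α ℝ (μ := μ)]
  refine tendsto_integral_filter_of_dominated_convergence (fun t => |K t|)
    (Eventually.of_forall fun y => (integrable_mul_exp hK ha h y).aestronglyMeasurable) ?_
    hK.abs ?_
  · filter_upwards [Ici_mem_atTop (0 : ℝ)] with x hx
    have hx : 0 ≤ x := hx
    filter_upwards [h] with t ht
    rw [norm_mul, Real.norm_eq_abs, Real.norm_of_nonneg (Real.exp_pos _).le]
    refine mul_le_of_le_one_right (abs_nonneg _) (Real.exp_le_one_iff.2 ?_)
    have := mul_nonneg ht.1.le hx
    linarith
  · filter_upwards [h] with t ht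
    have h1 : Tendsto (fun x => Real.exp (-(a t * x))) atTop (𝓝 0) :=
      Real.tendsto_exp_neg_atTop_nhds_zero.comp (tendsto_id.const_mul_atTop ht.1)
    simpa using h1.const_mul (K t)

end LaplaceKernel

/-! ### Explicit solutions for exponential right-hand sides. -/

open MeasureTheory in
/-- The equation `λ u - γ x u'' - b u' = e^{-s x}` has the solution
`u(x) = ∫₀^∞ e^{-λ t} (1 + γ s t)^{-b/γ} e^{-s x / (1 + γ s t)} dt`. -/
theorem exists_solution_exp {γ b lam s : ℝ} (hγ : 0 < γ) (hb : 0 < b) (hlam : 0 < lam)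
    (hs : 0 < s) :
    ∃ U W V : ℝ → ℝ, (∀ x, HasDerivAt U (W x) x) ∧ (∀ x, HasDerivAt W (V x) x) ∧
      (∀ x, γ * x * V x + b * W x = lam * U x - Real.exp (-(s * x))) ∧
      Tendsto U atTop (𝓝 0) ∧ Tendsto W atTop (𝓝 0) := by
  -- With $K=e^{-\lambda t}k$, the ansatz $v=k(t)e^{-a(t)x}$ for $v_t=Av$, $v(0)=e^{-sx}$ requires
  -- $a'=-\gamma a^2$ and $k'=-bak$, which gives these formulas.
  set p : ℝ → ℝ := fun t => 1 + γ * s * t with hp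
  set a : ℝ → ℝ := fun t => s / p t with ha_def
  set K : ℝ → ℝ := fun t => Real.exp (-lam * t) * p t ^ (-(b / γ)) with hK_def
  have hp1 : ∀ t, 0 ≤ t → 1 ≤ p t := fun t ht => by
    have : 0 ≤ γ * s * t := by positivity
    simp only [hp]
    linarith
  have hp' : ∀ t, HasDerivAt p (γ * s) t := fun t => by
    exact (((hasDerivAt_id t).const_mul (γ * s)).const_add 1).congr_deriv (mul_one _)
  have ha' : ∀ t, 0 ≤ t → HasDerivAt a (-γ * a t ^ 2) t := fun t ht => by
    have h0 : p t ≠ 0 := by linarith [hp1 t ht]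
    refine ((hasDerivAt_const t s).fun_div (hp' t) h0).congr_deriv ?_
    simp only [ha_def]
    field_simp
    ring
  have hK' : ∀ t, 0 ≤ t → HasDerivAt K (K t * (-lam - b * a t)) t := fun t ht => by
    have h0 : 0 < p t := by linarith [hp1 t ht]
    have h1 : HasDerivAt (fun t : ℝ => Real.exp (-lam * t)) (Real.exp (-lam * t) * (-lam * 1)) t :=
      ((hasDerivAt_id t).const_mul (-lam)).exp
    refine (h1.mul ((hp' t).rpow_const (p := -(b / γ)) (Or.inl h0.ne'))).congr_deriv ?_
    rw [Real.rpow_sub_one h0.ne']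
    simp only [hK_def, ha_def]
    field_simp
    ring
  have hpm : Measurable p := by fun_prop
  have ham : AEStronglyMeasurable a (volume.restrict (Ioi 0)) :=
    (hpm.const_div s).aestronglyMeasurable
  have ha : ∀ᵐ t ∂(volume.restrict (Ioi (0 : ℝ))), 0 < a t ∧ a t ≤ s := by
    filter_upwards [ae_restrict_mem measurableSet_Ioi] with t ht
    have h1 := hp1 t (le_of_lt ht)
    exact ⟨div_pos hs (by linarith), div_le_self hs.le h1⟩
  have hK : Integrable K (volume.restrict (Ioi 0)) := by
    refine (exp_neg_integrableOn_Ioi 0 hlam).mul_bdd (c := 1)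
      (hpm.pow_const _).aestronglyMeasurable ?_
    filter_upwards [ae_restrict_mem measurableSet_Ioi] with t ht
    have h1 := hp1 t (le_of_lt ht)
    rw [Real.norm_of_nonneg (Real.rpow_nonneg (by linarith) _)]
    exact Real.rpow_le_one_of_one_le_of_nonpos h1 (neg_nonpos.2 (by positivity))
  have hKa := integrable_mul_rate hK ham ha
  have hKaa := integrable_mul_rate hKa ham ha
  refine ⟨fun x => ∫ t in Ioi 0, K t * Real.exp (-(a t * x)),
    fun x => -∫ t in Ioi 0, K t * a t * Real.exp (-(a t * x)),
    fun x => ∫ t in Ioi 0, K t * a t * a t * Real.exp (-(a t * x)),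
    hasDerivAt_integral_mul_exp hK ham ha, fun x => ?_, fun x => ?_,
    tendsto_integral_mul_exp hK ham ha, ?_⟩
  · exact (hasDerivAt_integral_mul_exp hKa ham ha x).fun_neg.congr_deriv (neg_neg _)
  · have i0 := (integrable_mul_exp hK ham ha x).const_mul lam
    have i1 := (integrable_mul_exp hKa ham ha x).const_mul b
    have i2 := (integrable_mul_exp hKaa ham ha x).const_mul (γ * x)
    -- The $t$-derivative of the integrand is $A-\lambda$ applied to it in $x$; integrated over
    -- $(0,\infty)$ it yields minus the value $e^{-sx}$ at $t=0$.
    have hd : ∀ t, 0 ≤ t → HasDerivAt (fun t => K t * Real.exp (-(a t * x)))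
        (γ * x * (K t * a t * a t * Real.exp (-(a t * x))) -
          b * (K t * a t * Real.exp (-(a t * x))) - lam * (K t * Real.exp (-(a t * x)))) t :=
      fun t ht => ((hK' t ht).mul ((ha' t ht).mul_const x).fun_neg.exp).congr_deriv (by ring)
    have hlim : Tendsto (fun t => K t * Real.exp (-(a t * x))) atTop (𝓝 0) := by
      have h1 : Tendsto (fun t => Real.exp (-lam * t) * Real.exp (s * |x|)) atTop (𝓝 0) := by
        have h2 : Tendsto (fun t => Real.exp (-lam * t)) atTop (𝓝 0) :=
          Real.tendsto_exp_atBot.comp (tendsto_id.const_mul_atTop_of_neg (by linarith))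
        simpa using h2.mul_const (Real.exp (s * |x|))
      refine squeeze_zero_norm' ?_ h1
      filter_upwards [Ici_mem_atTop (0 : ℝ)] with t ht
      have h1 := hp1 t ht
      have h2 : 0 ≤ p t ^ (-(b / γ)) := Real.rpow_nonneg (by linarith) _
      have h3 : p t ^ (-(b / γ)) ≤ 1 :=
        Real.rpow_le_one_of_one_le_of_nonpos h1 (neg_nonpos.2 (by positivity))
      have h4 : 0 ≤ K t := mul_nonneg (Real.exp_pos _).le h2
      rw [Real.norm_of_nonneg (mul_nonneg h4 (Real.exp_pos _).le)]
      exact mul_le_mul (mul_le_of_le_one_right (Real.exp_pos _).le h3)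
        (exp_neg_mul_le (div_nonneg hs.le (by linarith)) (div_le_self hs.le h1) le_rfl)
        (Real.exp_pos _).le (Real.exp_pos _).le
    have h := integral_Ioi_of_hasDerivAt_of_tendsto (hd 0 le_rfl).continuousAt.continuousWithinAt
      (fun t ht => hd t (le_of_lt ht)) ((i2.sub i1).sub i0) hlim
    have h1 := integral_sub (i2.sub i1) i0
    simp only [Pi.sub_apply] at h1
    rw [h1, integral_sub i2 i1, integral_const_mul, integral_const_mul, integral_const_mul] at h
    have h0 : K 0 * Real.exp (-(a 0 * x)) = Real.exp (-(s * x)) := by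
      simp [hK_def, ha_def, hp]
    rw [h0] at h
    linarith
  · simpa using (tendsto_integral_mul_exp hKa ham ha).neg

theorem hasDerivAt_ofReal_comp {h : ℝ → ℝ} {h' x : ℝ} (hh : HasDerivAt h h' x) :
    HasDerivAt (fun y => (h y : 𝕜)) (h' : 𝕜) x :=
  (RCLike.ofRealCLM (K := 𝕜)).hasFDerivAt.comp_hasDerivAt x hh

/-- A classical real solution on the line gives an element of the solution space. -/
theorem exists_mem_solutionSpace_of_hasDerivAt {γ b lam l : ℝ} {U W V g : ℝ → ℝ}
    (hU : ∀ x, HasDerivAt U (W x) x) (hW : ∀ x, HasDerivAt W (V x) x)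
    (heq : ∀ x, γ * x * V x + b * W x = lam * U x - g x)
    (hU' : Tendsto U atTop (𝓝 l)) (hW' : Tendsto W atTop (𝓝 0))
    (hg' : Tendsto g atTop (𝓝 (lam * l))) {f : CInfty 𝕜}
    (hf : ∀ x : ℝ, 0 ≤ x → onReal f x = (g x : 𝕜)) :
    ∃ u w : CInfty 𝕜, (u, w, f) ∈ solutionSpace 𝕜 γ b lam := by
  have hcast : ∀ {h : ℝ → ℝ} {m : ℝ}, Tendsto h atTop (𝓝 m) →
      Tendsto (fun x => (h x : 𝕜)) atTop (𝓝 (m : 𝕜)) := fun h =>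
    (RCLike.continuous_ofReal.tendsto _).comp h
  obtain ⟨u, hu⟩ := exists_onReal_eq (fun x => (U x : 𝕜))
    (fun x _ => (hasDerivAt_ofReal_comp (hU x)).continuousAt.continuousWithinAt) _ (hcast hU')
  obtain ⟨w, hw⟩ := exists_onReal_eq (fun x => (W x : 𝕜))
    (fun x _ => (hasDerivAt_ofReal_comp (hW x)).continuousAt.continuousWithinAt) _ (hcast hW')
  replace hu : ∀ x : ℝ, 0 ≤ x → onReal u x = (U x : 𝕜) := hu
  replace hw : ∀ x : ℝ, 0 ≤ x → onReal w x = (W x : 𝕜) := hw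
  have hq : ∀ x, 0 ≤ x → onReal ((γ : 𝕜) • w + ((lam : 𝕜) • u - f) - (b : 𝕜) • w) x =
      ((γ * W x + γ * x * V x : ℝ) : 𝕜) := fun x hx => by
    have h1 : γ * W x + γ * x * V x = γ * W x + (lam * U x - g x) - b * W x := by
      linarith [heq x]
    rw [h1]
    simp only [RCLike.ofReal_add, RCLike.ofReal_sub, RCLike.ofReal_mul]
    rw [← hu x hx, ← hw x hx, ← hf x hx]
    rfl
  refine ⟨u, w, mem_solutionSpace.2 ⟨fun x hx => ?_, fun x hx => ?_, ?_, ?_, ?_⟩⟩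
  · rw [integralCLM_apply, intervalIntegral.integral_eq_sub_of_hasDerivAt
      (f := fun x => (U x : 𝕜)) (fun t ht => ?_) ((continuous_onReal w).intervalIntegrable _ _),
      hu x hx, hu 0 le_rfl, add_sub_cancel]
    rw [uIcc_of_le hx] at ht
    rw [hw t ht.1]
    exact hasDerivAt_ofReal_comp (hU t)
  · rw [integralCLM_apply, intervalIntegral.integral_eq_sub_of_hasDerivAt
      -- $\gamma xW$ is a primitive of $\gamma W+\gamma xV$.
      (f := fun x => ((γ * x * W x : ℝ) : 𝕜)) (fun t ht => ?_)
      ((continuous_onReal _).intervalIntegrable _ _), hw x hx, RCLike.real_smul_eq_coe_mul]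
    · simp
    rw [uIcc_of_le hx] at ht
    rw [hq t ht.1]
    have h1 : HasDerivAt (fun x => γ * x) γ t := by simpa using (hasDerivAt_id t).const_mul γ
    exact hasDerivAt_ofReal_comp (h1.mul (hW t))
  · have h0 := heq 0
    have h1 : lam * U 0 - g 0 - b * W 0 = 0 := by linarith
    rw [hu 0 le_rfl, hf 0 le_rfl, hw 0 le_rfl, RCLike.real_smul_eq_coe_mul,
      RCLike.real_smul_eq_coe_mul]
    exact_mod_cast congrArg (RCLike.ofReal (K := 𝕜)) h1
  · have h := hcast hW'
    rw [RCLike.ofReal_zero] at h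
    refine h.congr' ?_
    filter_upwards [Ici_mem_atTop (0 : ℝ)] with x hx using (hw x hx).symm
  · have h := hcast ((hU'.const_mul lam).sub hg')
    rw [sub_self, RCLike.ofReal_zero] at h
    refine h.congr' ?_
    filter_upwards [Ici_mem_atTop (0 : ℝ)] with x hx
    simp only [RCLike.ofReal_sub, RCLike.ofReal_mul]
    rw [← hu x hx, ← hf x hx]
    rfl

/-! ### Density of the solvable right-hand sides. -/

variable (𝕜) in
/-- The right-hand sides `f` for which `λ u - A u = f` is solvable. -/
noncomputable def solvableRhs (γ b lam : ℝ) : Submodule 𝕜 (CInfty 𝕜) :=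
  (solutionSpace 𝕜 γ b lam).map (LinearMap.snd 𝕜 _ _ ∘ₗ LinearMap.snd 𝕜 _ _)

theorem mem_solvableRhs {γ b lam : ℝ} {f : CInfty 𝕜} :
    f ∈ solvableRhs 𝕜 γ b lam ↔ ∃ u w : CInfty 𝕜, (u, w, f) ∈ solutionSpace 𝕜 γ b lam := by
  simp [solvableRhs]

theorem exists_mem_solvableRhs_exp {γ b lam : ℝ} (hγ : 0 < γ) (hb : 0 < b) (hlam : 0 < lam)
    (n : ℕ) : ∃ f ∈ solvableRhs 𝕜 γ b lam,
      ∀ x : ℝ, 0 ≤ x → onReal f x = ((Real.exp (-x) ^ n : ℝ) : 𝕜) := by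
  have hexp : ∀ x, Real.exp (-x) ^ n = Real.exp (-(n * x)) := fun x => by
    rw [← Real.exp_nat_mul]
    congr 1
    ring
  have hc : Continuous fun x : ℝ => ((Real.exp (-x) ^ n : ℝ) : 𝕜) := by fun_prop
  simp only [mem_solvableRhs]
  rcases Nat.eq_zero_or_pos n with rfl | hn
  -- The Laplace formula needs a positive rate, so the constant $1$ is treated separately, with
  -- solution $1/\lambda$.
  · obtain ⟨f, hf⟩ := exists_onReal_eq _ hc.continuousOn 1 (by simp)
    refine ⟨f, exists_mem_solutionSpace_of_hasDerivAt (U := fun _ => lam⁻¹) (W := fun _ => 0)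
      (V := fun _ => 0) (g := fun x => Real.exp (-x) ^ 0) (l := lam⁻¹)
      (fun x => hasDerivAt_const x _) (fun x => hasDerivAt_const x _) (fun x => ?_)
      tendsto_const_nhds tendsto_const_nhds ?_ hf, hf⟩
    · simp [mul_inv_cancel₀ hlam.ne']
    · simp [mul_inv_cancel₀ hlam.ne']
  · have ht : Tendsto (fun x : ℝ => Real.exp (-x) ^ n) atTop (𝓝 0) := by
      simpa [hn.ne'] using Real.tendsto_exp_neg_atTop_nhds_zero.pow n
    obtain ⟨f, hf⟩ := exists_onReal_eq _ hc.continuousOn _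
      ((RCLike.continuous_ofReal.tendsto _).comp ht)
    obtain ⟨U, W, V, hU, hW, heq, hU', hW'⟩ :=
      exists_solution_exp hγ hb hlam (Nat.cast_pos.2 hn)
    exact ⟨f, exists_mem_solutionSpace_of_hasDerivAt hU hW
      (fun x => (heq x).trans (by rw [hexp])) hU' hW' (by simpa using ht) hf, hf⟩

theorem exists_mem_solvableRhs_polynomial {γ b lam : ℝ} (hγ : 0 < γ) (hb : 0 < b) (hlam : 0 < lam)
    (p : Polynomial ℝ) : ∃ f ∈ solvableRhs 𝕜 γ b lam,
      ∀ x : ℝ, 0 ≤ x → onReal f x = ((p.eval (Real.exp (-x)) : ℝ) : 𝕜) := by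
  induction p using Polynomial.induction_on' with
  | add p q hp hq =>
    obtain ⟨f, hf, hf'⟩ := hp
    obtain ⟨g, hg, hg'⟩ := hq
    refine ⟨f + g, add_mem hf hg, fun x hx => ?_⟩
    rw [onReal_add, Pi.add_apply, hf' x hx, hg' x hx, Polynomial.eval_add, RCLike.ofReal_add]
  | monomial n c =>
    obtain ⟨f, hf, hf'⟩ := exists_mem_solvableRhs_exp (𝕜 := 𝕜) hγ hb hlam n
    refine ⟨(c : 𝕜) • f, Submodule.smul_mem _ _ hf, fun x hx => ?_⟩
    rw [onReal_smul, Pi.smul_apply, hf' x hx, Polynomial.eval_monomial, RCLike.ofReal_mul,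
      smul_eq_mul]

/-- Every element of `C([0,∞])` is a continuous function of `e^{-x}`. -/
theorem exists_continuous_comp_exp (f : CInfty 𝕜) :
    ∃ H : ℝ → 𝕜, Continuous H ∧ ∀ x : ℝ, onReal f x = H (Real.exp (-x)) := by
  -- The value at $y=0$ is the limit at infinity. `Real.log` is even, so the formula is also
  -- continuous for negative $y$.
  refine ⟨Function.update (fun y => onReal f (-Real.log y)) 0 (limCLM 𝕜 f),
    continuous_iff_continuousAt.2 fun y => ?_, fun x => ?_⟩
  · rcases eq_or_ne y 0 with rfl | hy
    · rw [continuousAt_update_same]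
      exact (tendsto_limCLM f).comp
        (tendsto_neg_atBot_atTop.comp Real.tendsto_log_nhdsNE_zero)
    · rw [continuousAt_update_of_ne hy]
      exact (continuous_onReal f).continuousAt.comp (Real.continuousAt_log hy).neg
  · rw [Function.update_of_ne (Real.exp_pos _).ne', Real.log_exp, neg_neg]

/-- Weierstrass approximation in $y=e^{-x}\in[0,1]$, applied to real and imaginary parts. -/
theorem dense_solvableRhs {γ b lam : ℝ} (hγ : 0 < γ) (hb : 0 < b) (hlam : 0 < lam) :
    Dense (solvableRhs 𝕜 γ b lam : Set (CInfty 𝕜)) := by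
  intro f
  rw [Metric.mem_closure_iff]
  intro ε hε
  obtain ⟨H, hH, hfH⟩ := exists_continuous_comp_exp f
  obtain ⟨p, hp⟩ := exists_polynomial_near_of_continuousOn 0 1 (fun y => RCLike.re (H y))
    (RCLike.continuous_re.comp hH).continuousOn (ε / 4) (by linarith)
  obtain ⟨q, hq⟩ := exists_polynomial_near_of_continuousOn 0 1 (fun y => RCLike.im (H y))
    (RCLike.continuous_im.comp hH).continuousOn (ε / 4) (by linarith)
  obtain ⟨g, hg, hg'⟩ := exists_mem_solvableRhs_polynomial (𝕜 := 𝕜) hγ hb hlam p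
  obtain ⟨h, hh, hh'⟩ := exists_mem_solvableRhs_polynomial (𝕜 := 𝕜) hγ hb hlam q
  refine ⟨g + (RCLike.I : 𝕜) • h, add_mem hg (Submodule.smul_mem _ _ hh), ?_⟩
  rw [dist_eq_norm, norm_sub_rev]
  refine (norm_le_of_forall (M := ε / 2) (by linarith) fun x hx => ?_).trans_lt (by linarith)
  have hy : Real.exp (-x) ∈ Icc (0 : ℝ) 1 :=
    ⟨(Real.exp_pos _).le, Real.exp_le_one_iff.2 (by linarith)⟩
  have h1 : onReal (g + (RCLike.I : 𝕜) • h - f) x =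
      ((p.eval (Real.exp (-x)) - RCLike.re (H (Real.exp (-x))) : ℝ) : 𝕜) +
        ((q.eval (Real.exp (-x)) - RCLike.im (H (Real.exp (-x))) : ℝ) : 𝕜) * RCLike.I := by
    have h2 : onReal (g + (RCLike.I : 𝕜) • h - f) x =
      onReal g x + RCLike.I * onReal h x - onReal f x := rfl
    rw [h2, hg' x hx, hh' x hx, hfH x]
    nth_rewrite 1 [← RCLike.re_add_im (H (Real.exp (-x)))]
    push_cast
    ring
  rw [h1]
  refine (norm_add_le _ _).trans ?_
  rw [norm_mul, RCLike.norm_ofReal, RCLike.norm_ofReal]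
  have h3 := hp _ hy
  have h4 := hq _ hy
  -- Only an inequality, since `RCLike.I` is $0$ over the reals.
  have h5 : ‖(RCLike.I : 𝕜)‖ ≤ 1 := by
    rcases RCLike.I_eq_zero_or_im_I_eq_one (K := 𝕜) with h | h
    · simp [h]
    · exact (RCLike.norm_I_of_ne_zero (fun h0 => by simp [h0] at h)).le
  have h6 := mul_le_of_le_one_right
    (abs_nonneg (q.eval (Real.exp (-x)) - RCLike.im (H (Real.exp (-x))))) h5
  linarith

/-! ### Closed range and the resolvent. -/

variable (𝕜) in
/-- The map `(u, w, f) ↦ f` on the solution space. -/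
noncomputable def toRhs (γ b lam : ℝ) : solutionSpace 𝕜 γ b lam →L[𝕜] CInfty 𝕜 :=
  ((ContinuousLinearMap.snd 𝕜 (CInfty 𝕜) (CInfty 𝕜)).comp
    (ContinuousLinearMap.snd 𝕜 (CInfty 𝕜) (CInfty 𝕜 × CInfty 𝕜))).comp
    (solutionSpace 𝕜 γ b lam).subtypeL

@[simp] theorem toRhs_apply {γ b lam : ℝ} (z : solutionSpace 𝕜 γ b lam) :
    toRhs 𝕜 γ b lam z = z.1.2.2 := rfl

/-- The three summands bound $u$, $w$ and $f$ itself; their sum dominates the maximum norm of the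
triple. -/
theorem antilipschitz_toRhs {γ b lam : ℝ} (hγ : 0 < γ) (hb : 0 < b) (hlam : 0 < lam) :
    AntilipschitzWith (1 / lam + 2 / b + 1).toNNReal (toRhs 𝕜 γ b lam) := by
  refine AddMonoidHomClass.antilipschitz_of_bound (toRhs 𝕜 γ b lam) ?_
  rintro ⟨⟨u, w, f⟩, h⟩
  rw [Real.coe_toNNReal _ (by positivity)]
  have h1 := norm_fst_le_of_mem hγ hb hlam h
  have h2 := norm_snd_le_of_mem hγ hb hlam h
  have h3 : 0 ≤ ‖f‖ / lam := by positivity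
  have h4 : 0 ≤ 2 * ‖f‖ / b := by positivity
  have h5 : (1 / lam + 2 / b + 1) * ‖f‖ = ‖f‖ / lam + 2 * ‖f‖ / b + ‖f‖ := by ring
  have h6 := norm_nonneg f
  change max ‖u‖ (max ‖w‖ ‖f‖) ≤ (1 / lam + 2 / b + 1) * ‖f‖
  rw [h5]
  refine max_le ?_ (max_le ?_ ?_) <;> linarith

theorem isClosed_range_toRhs {γ b lam : ℝ} (hγ : 0 < γ) (hb : 0 < b) (hlam : 0 < lam) :
    IsClosed (range (toRhs 𝕜 γ b lam)) := by
  have : CompleteSpace (solutionSpace 𝕜 γ b lam) :=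
    (isClosed_solutionSpace γ b lam).completeSpace_coe
  have hu : UniformContinuous (toRhs 𝕜 γ b lam) :=
    uniformContinuous_snd.comp (uniformContinuous_snd.comp uniformContinuous_subtype_val)
  exact (antilipschitz_toRhs hγ hb hlam).isClosed_range hu

theorem solvableRhs_subset_range (γ b lam : ℝ) :
    (solvableRhs 𝕜 γ b lam : Set (CInfty 𝕜)) ⊆ range (toRhs 𝕜 γ b lam) := by
  intro g hg
  obtain ⟨u, w, h⟩ := mem_solvableRhs.1 hg
  exact ⟨⟨_, h⟩, toRhs_apply _⟩

/-- The range is closed and contains a dense subspace. -/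
theorem surjective_toRhs {γ b lam : ℝ} (hγ : 0 < γ) (hb : 0 < b) (hlam : 0 < lam) :
    Function.Surjective (toRhs 𝕜 γ b lam) := fun f =>
  closure_minimal (solvableRhs_subset_range γ b lam) (isClosed_range_toRhs hγ hb hlam)
    (dense_solvableRhs hγ hb hlam f)

theorem bijective_toRhs {γ b lam : ℝ} (hγ : 0 < γ) (hb : 0 < b) (hlam : 0 < lam) :
    Function.Bijective (toRhs 𝕜 γ b lam) :=
  ⟨(antilipschitz_toRhs hγ hb hlam).injective, surjective_toRhs hγ hb hlam⟩

/-- The solution operators `R : f ↦ u` and `T : f ↦ u'` of the equation `λ u - A u = f`. -/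
theorem exists_solution_operators {γ b lam : ℝ} (hγ : 0 < γ) (hb : 0 < b) (hlam : 0 < lam) :
    ∃ R T : CInfty 𝕜 →L[𝕜] CInfty 𝕜, ∀ f, (R f, T f, f) ∈ solutionSpace 𝕜 γ b lam := by
  set e := LinearEquiv.ofBijective (toRhs 𝕜 γ b lam : solutionSpace 𝕜 γ b lam →ₗ[𝕜] CInfty 𝕜)
    (bijective_toRhs hγ hb hlam) with he
  have hmem : ∀ f, ((e.symm f).1.1, (e.symm f).1.2.1, f) ∈ solutionSpace 𝕜 γ b lam := fun f => by
    have h1 : (e.symm f).1.2.2 = f := e.apply_symm_apply f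
    have h2 := (e.symm f).2
    nth_rewrite 3 [← h1]
    exact h2
  refine ⟨LinearMap.mkContinuous (LinearMap.fst 𝕜 _ _ ∘ₗ
      (solutionSpace 𝕜 γ b lam).subtype ∘ₗ e.symm.toLinearMap) (1 / lam) fun f => ?_,
    LinearMap.mkContinuous (LinearMap.fst 𝕜 _ _ ∘ₗ LinearMap.snd 𝕜 _ _ ∘ₗ
      (solutionSpace 𝕜 γ b lam).subtype ∘ₗ e.symm.toLinearMap) (2 / b) fun f => ?_, hmem⟩
  · exact (norm_fst_le_of_mem hγ hb hlam (hmem f)).trans_eq (by ring)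
  · exact (norm_snd_le_of_mem hγ hb hlam (hmem f)).trans_eq (by ring)

theorem isResolventAt_of_forall_mem {γ b lam : ℝ} (hγ : 0 < γ) (hb : 0 < b) (hlam : 0 < lam)
    {R T : CInfty 𝕜 →L[𝕜] CInfty 𝕜} (h : ∀ f, (R f, T f, f) ∈ solutionSpace 𝕜 γ b lam) :
    Unbounded.IsResolventAt (opA 𝕜 γ b) (lam : 𝕜) R := by
  have happ : ∀ (u : (opA 𝕜 γ b).domain) (x : ℝ), 0 ≤ x →
      onReal (opA 𝕜 γ b u) x = diffExpr γ b (onReal u.1) x := fun u x hx => by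
    have := opA_apply u x.toNNReal
    rwa [Real.coe_toNNReal x hx] at this
  have hright : ∀ f, ∃ hf : R f ∈ (opA 𝕜 γ b).domain,
      (lam : 𝕜) • R f - opA 𝕜 γ b ⟨R f, hf⟩ = f := fun f => by
    refine ⟨inDomain_of_mem hγ (h f), ext_onReal fun x hx => ?_⟩
    change (lam : 𝕜) • onReal (R f) x - onReal (opA 𝕜 γ b ⟨R f, _⟩) x = _
    rw [happ _ x hx, diffExpr_of_mem hγ (h f) hx, RCLike.real_smul_eq_coe_smul (K := 𝕜),
      sub_sub_cancel]
  refine ⟨hright, fun u => ?_⟩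
  obtain ⟨hd, he⟩ := hright ((lam : 𝕜) • (u : CInfty 𝕜) - opA 𝕜 γ b u)
  -- The difference of two domain elements with the same right-hand side solves the homogeneous
  -- equation, so the maximum principle makes it zero. Nothing about $u'$ at infinity is required of
  -- $u$.
  set v : (opA 𝕜 γ b).domain := ⟨_, hd⟩ - u with hv
  have h0 : (lam : 𝕜) • (v : CInfty 𝕜) - opA 𝕜 γ b v = 0 := by
    have h2 : opA 𝕜 γ b v = opA 𝕜 γ b ⟨_, hd⟩ - opA 𝕜 γ b u := LinearPMap.map_sub _ _ _
    have h3 : (v : CInfty 𝕜) = R ((lam : 𝕜) • (u : CInfty 𝕜) - opA 𝕜 γ b u) - u := rfl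
    rw [h2, h3, smul_sub, sub_sub_sub_comm, he, sub_self]
  have h1 : ‖(v : CInfty 𝕜)‖ ≤ ‖(0 : CInfty 𝕜)‖ / lam :=
    InDomain.norm_le hγ hb hlam v.2 fun x hx => by
      rw [← happ v x hx, ← h0, RCLike.real_smul_eq_coe_smul (K := 𝕜)]
      rfl
  rw [norm_zero, zero_div, norm_le_zero_iff, hv] at h1
  exact sub_eq_zero.1 h1

end HalfLine

/-- Identifies the resolvent obtained by choice with the constructed operator. -/
theorem Unbounded.IsResolventAt.unique {𝕜 E : Type*} [NontriviallyNormedField 𝕜]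
    [NormedAddCommGroup E] [NormedSpace 𝕜 E] {A : E →ₗ.[𝕜] E} {z : 𝕜} {R S : E →L[𝕜] E}
    (hR : Unbounded.IsResolventAt A z R) (hS : Unbounded.IsResolventAt A z S) : R = S := by
  ext f
  obtain ⟨h, hf⟩ := hS.1 f
  have := hR.2 ⟨S f, h⟩
  rwa [hf] at this

theorem proposition5p2 {𝕜 : Type*} [RCLike 𝕜] :
    ∃ C : ℝ, 0 < C ∧ ∀ γ b : ℝ, 0 < γ → 0 < b → ∀ lam : ℝ, 0 < lam →
      (lam : 𝕜) ∈ Unbounded.resolventSet (HalfLine.opA 𝕜 γ b) ∧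
      ∃ T : HalfLine.CInfty 𝕜 →L[𝕜] HalfLine.CInfty 𝕜,
        (∀ (f : HalfLine.CInfty 𝕜) (x : ℝ), 0 ≤ x →
          HasDerivWithinAt
            (HalfLine.onReal (Unbounded.resolvent (lam : 𝕜) (HalfLine.opA 𝕜 γ b) f))
            (HalfLine.onReal (T f) x) (Set.Ici 0) x) ∧
        ∀ f : HalfLine.CInfty 𝕜, ‖T f‖ ≤ 1 / γ * max 2 (γ / b) * C * ‖f‖ := by
  -- The constant $2$ counts the two terms of $\lambda u-f$, each bounded by $\|f\|$.
  refine ⟨2, two_pos, fun γ b hγ hb lam hlam => ?_⟩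
  obtain ⟨R, T, h⟩ := HalfLine.exists_solution_operators (𝕜 := 𝕜) hγ hb hlam
  have hR := HalfLine.isResolventAt_of_forall_mem hγ hb hlam h
  have hmem : (lam : 𝕜) ∈ Unbounded.resolventSet (HalfLine.opA 𝕜 γ b) := ⟨R, hR⟩
  refine ⟨hmem, T, fun f x hx => ?_, fun f => ?_⟩
  · rw [(Unbounded.resolvent_spec hmem).unique hR]
    exact HalfLine.hasDerivWithinAt_of_mem (h f) hx
  · have h1 : 1 / b ≤ 1 / γ * max 2 (γ / b) := by
      calc 1 / b = 1 / γ * (γ / b) := by field_simp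
        _ ≤ _ := mul_le_mul_of_nonneg_left (le_max_right _ _) (by positivity)
    calc ‖T f‖ ≤ 2 * ‖f‖ / b := HalfLine.norm_snd_le_of_mem hγ hb hlam (h f)
      _ = 1 / b * (2 * ‖f‖) := by ring
      _ ≤ 1 / γ * max 2 (γ / b) * (2 * ‖f‖) := mul_le_mul_of_nonneg_right h1 (by positivity)
      _ = _ := by ring
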